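/- A \emph{GO space} (generalized ordered space) is a topological space that is homeomorphic to a subspace of a linearly ordered set equipped with its order topology. A topological space $X$ is \emph{scattered} if every nonempty subset $S\subseteq X$ has a point that is isolated in $S$, and \emph{locally countable} if every point of $X$ has a countable neighbourhood. A set $A\subseteq X$ is \emph{strongly dense} in a family $\mathcal F$ of subsets of $X$ if $A\cap\bigcap\mathcal G\neq\emptyset$ for every $\mathcal G\subseteq\mathcal F$ with $\bigcap\mathcal G\neq\emptyset$ (where $\bigcap\emptyset=X$). \textbf{Theorem.} Let $X$ be a GO space that is either scattered or locally countable. Then the following are equivalent: \begin{enumerate} \item[(i)] $X$ is functionally countable, that is, every continuous function $f\colon X\to\mathbb R$ has countable image; \item[(ii)] $X$ is exponentially separable, that is, for every countable family $\mathcal F$ of closed subsets of $X$ there is a countable set $A\subseteq X$ that is strongly dense in $\mathcal F$; \item[(iii)] $X$ has countable extent, that is, every closed discrete subset of $X$ is countable. \end{enumerate} -/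

import Mathlib

open Set Topology

universe u v

/-- A set `A` is strongly dense in a family `F` of subsets of `X` if `A` meets `⋂ G` for every
subfamily `G ⊆ F` whose intersection is nonempty (the intersection of the empty family is `X`). -/
def StronglyDense {X : Type u} (A : Set X) (F : Set (Set X)) : Prop :=
  ∀ G : Set (Set X), G ⊆ F → (⋂₀ G).Nonempty → (A ∩ ⋂₀ G).Nonempty

/-- For every countable family of closed sets there is a countable strongly dense set. -/
def ExponentiallySeparable (X : Type u) [TopologicalSpace X] : Prop :=
  ∀ F : Set (Set X), F.Countable → (∀ C ∈ F, IsClosed C) →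
    ∃ A : Set X, A.Countable ∧ StronglyDense A F

/-- Every continuous real-valued function on `X` has countable image. -/
def FunctionallyCountable (X : Type u) [TopologicalSpace X] : Prop :=
  ∀ f : X → ℝ, Continuous f → (range f).Countable

/-- Every closed discrete subset of `X` is countable. -/
def HasCountableExtent (X : Type u) [TopologicalSpace X] : Prop :=
  ∀ D : Set X, IsClosed D → IsDiscrete D → D.Countable

/-- Generalized ordered (GO) spaces: `X` embeds as a subspace of a linearly ordered topological
space `Y`. The universe of `Y` is arbitrary. -/
def IsGOSpace (X : Type u) [TopologicalSpace X] : Prop :=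
  ∃ (Y : Type v) (_ : LinearOrder Y) (_ : TopologicalSpace Y) (_ : OrderTopology Y) (f : X → Y),
    IsEmbedding f

/-- Every nonempty subset `S` of `X` has a point that is isolated in `S`. -/
def IsScatteredSpace (X : Type u) [TopologicalSpace X] : Prop :=
  ∀ S : Set X, S.Nonempty → ∃ x ∈ S, ∃ U : Set X, IsOpen U ∧ U ∩ S = {x}

/-- Every point of `X` has a countable neighbourhood. -/
def IsLocallyCountable (X : Type u) [TopologicalSpace X] : Prop :=
  ∀ x : X, ∃ U ∈ 𝓝 x, U.Countable

/-!
The equivalence is proved as (ii) ⟹ (i) ⟹ (iii) ⟹ (ii).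

(ii) ⟹ (i): a set strongly dense in the preimages of the closed rational intervals meets every
fibre of `f`. (i) ⟹ (iii): a GO space is normal, so by Tietze's theorem every real function on a
closed discrete set extends, and an uncountable set has a real function with uncountable image.

(iii) ⟹ (ii): fix a countable family of closed sets `C i` and call `U ⊆ X` *dominated* if
countably many points `a` suffice to have, for each `x ∈ U`, one of them in every `C i` that
contains `x`. The claim is that `X` is dominated. Countable sets are dominated, and so are countable
unions of dominated sets.

* Countable extent enters through `HasCountableExtent.exists_maximal_pairwise`: a maximal set of
  points that are pairwise separated by a property `P` is countable, as soon as `P` fails for points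
  that are close together, because such a set is closed and discrete.
* `isDominated_of_locally`: a closed set `Z` all of whose points have dominated
  neighbourhoods is dominated. Taking for `P x y` that `[x, y]` is not dominated, one is reduced to
  the set `K` of those `z ≥ d` in `Z` with `[d, z]` dominated (and its mirror image). If a
  countable subset is cofinal in `K`, this is clear. Otherwise the `C i` that are bounded in `K`
  have a common bound, and those that are unbounded in `K` have a common point `a` by
  `exists_mem_of_unbounded`; beyond the common bound, `a` alone dominates.
* `exists_isDominated_nhds_of_isScatteredSpace`: in a scattered space all points have dominated
  neighbourhoods. A point `x` isolated in the set of exceptions is either the limit of a sequence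
  from the right, and then the previous result applies to intervals away from `x`; or the `C i`
  that miss `x` miss a common right neighbourhood of `x`, which is then dominated by `x` alone. The
  same holds on the left.
-/

open Filter

/-! ### Functionally countable spaces -/

theorem ExponentiallySeparable.functionallyCountable {X : Type u} [TopologicalSpace X]
    (h : ExponentiallySeparable X) : FunctionallyCountable X := by
  intro f hf
  obtain ⟨A, hA, hAd⟩ := h (range fun p : ℚ × ℚ => f ⁻¹' Icc (p.1 : ℝ) p.2) (countable_range _)
    (by rintro _ ⟨p, rfl⟩; exact isClosed_Icc.preimage hf)
  refine (hA.image f).mono ?_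
  rintro _ ⟨x, rfl⟩
  obtain ⟨a, haA, ha⟩ := hAd {S | S ∈ (range fun p : ℚ × ℚ => f ⁻¹' Icc (p.1 : ℝ) p.2) ∧ x ∈ S}
    (fun S hS => hS.1) ⟨x, fun S hS => hS.2⟩
  refine ⟨a, haA, ?_⟩
  have key : ∀ p q : ℚ, (p : ℝ) ≤ f x → f x ≤ q → (p : ℝ) ≤ f a ∧ f a ≤ q := fun p q hp hq =>
    ha _ ⟨⟨(p, q), rfl⟩, hp, hq⟩
  obtain ⟨p₀, hp₀⟩ := exists_rat_lt (f x)
  obtain ⟨q₀, hq₀⟩ := exists_rat_gt (f x)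
  refine le_antisymm (le_of_forall_rat_lt_imp_le ?_) (le_of_forall_rat_lt_imp_le ?_)
  · intro q hq
    by_contra! hlt
    obtain ⟨r, hr₁, hr₂⟩ := exists_rat_btwn hlt
    rcases le_or_gt (f x) r with h' | h'
    · linarith [(key p₀ r hp₀.le h').2]
    · linarith
  · intro q hq
    exact (key q q₀ hq.le hq₀.le).1

theorem FunctionallyCountable.hasCountableExtent {X : Type u} [TopologicalSpace X] [NormalSpace X]
    (h : FunctionallyCountable X) : HasCountableExtent X := by
  intro D hDc hDd
  have := hDd.to_subtype
  have key : ∀ g : D → ℝ, (range g).Countable := by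
    intro g
    obtain ⟨F, hF⟩ := ContinuousMap.exists_restrict_eq hDc ⟨g, continuous_of_discreteTopology⟩
    refine (h F F.continuous).mono ?_
    rintro _ ⟨x, rfl⟩
    exact ⟨x, congrArg (fun φ : C(D, ℝ) => φ x) hF⟩
  rcases Function.Embedding.total D ℝ with ⟨⟨e⟩⟩ | ⟨⟨e⟩⟩
  · have := (key e).to_subtype
    exact countable_coe_iff.1 (e.injective.codRestrict (fun x => mem_range_self x)).countable
  · have hs : Function.Surjective (Function.invFun e) := Function.invFun_surjective e.injective
    exact absurd (hs.range_eq ▸ key (Function.invFun e)) Cardinal.not_countable_real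

/-! ### Countable extent -/

/-- If `P` fails for all pairs of points that lie in `K` close to some common point, then a maximal
subset of `K` whose points are pairwise related by `P` is closed and discrete, hence countable. -/
theorem HasCountableExtent.exists_maximal_pairwise {X : Type u} [TopologicalSpace X] [T1Space X]
    [LinearOrder X] (hext : HasCountableExtent X) (P : X → X → Prop) (K : Set X)
    (hP : ∀ p, ∃ V ∈ 𝓝 p, ∀ x ∈ V ∩ K, ∀ y ∈ V ∩ K, x < y → ¬ P x y) :
    ∃ D ⊆ K, D.Countable ∧
      ∀ x ∈ K, (∀ d ∈ D, (d < x → P d x) ∧ (x < d → P x d)) → x ∈ D := by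
  obtain ⟨D, hD⟩ := zorn_subset {D : Set X | D ⊆ K ∧ ∀ x ∈ D, ∀ y ∈ D, x < y → P x y} (by
    intro c hc hchain
    refine ⟨⋃₀ c, ⟨sUnion_subset fun s hs => (hc hs).1, ?_⟩, fun s hs => subset_sUnion_of_mem hs⟩
    rintro x ⟨s, hs, hxs⟩ y ⟨t, ht, hyt⟩ hxy
    rcases hchain.total hs ht with hst | hts
    · exact (hc ht).2 x (hst hxs) y hyt hxy
    · exact (hc hs).2 x hxs y (hts hyt) hxy)
  obtain ⟨hDK, hDP⟩ := hD.prop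
  have hcd : IsClosed D ∧ IsDiscrete D := by
    rw [isClosed_and_discrete_iff]
    intro p
    obtain ⟨V, hV, hVP⟩ := hP p
    have hsub : (V ∩ D).Subsingleton := by
      intro x hx y hy
      by_contra hne
      rcases lt_or_gt_of_ne hne with hlt | hlt
      · exact hVP x ⟨hx.1, hDK hx.2⟩ y ⟨hy.1, hDK hy.2⟩ hlt (hDP x hx.2 y hy.2 hlt)
      · exact hVP y ⟨hy.1, hDK hy.2⟩ x ⟨hx.1, hDK hx.2⟩ hlt (hDP y hy.2 x hx.2 hlt)
    rw [Filter.disjoint_principal_right]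
    -- Remove from `V` its only point of `D`, which is harmless in a punctured neighbourhood.
    have hfin : ((V ∩ D) \ {p})ᶜ ∈ 𝓝 p :=
      (hsub.anti sdiff_subset).finite.isClosed.isOpen_compl.mem_nhds (by simp)
    filter_upwards [mem_nhdsWithin_of_mem_nhds hV, mem_nhdsWithin_of_mem_nhds hfin,
      self_mem_nhdsWithin] with x hxV hx hxp hxD
    exact hx ⟨⟨hxV, hxD⟩, hxp⟩
  refine ⟨D, hDK, hext D hcd.1 hcd.2, fun x hx hxD => ?_⟩
  refine hD.le_of_ge (y := insert x D) ⟨insert_subset hx hDK, ?_⟩ (subset_insert x D)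
    (mem_insert x D)
  rintro y (rfl | hy) z (rfl | hz) hyz
  · exact absurd hyz (lt_irrefl _)
  · exact (hxD z hz).2 hyz
  · exact (hxD y hy).1 hyz
  · exact hDP y hy z hz hyz

/-! ### Dominated sets -/

/-- `U` is dominated with respect to the family `C` if there is a countable set `A` such that each
`x ∈ U` admits some `a ∈ A` lying in all the `C i` that contain `x`. -/
def IsDominated {X : Type u} {ι : Type*} (C : ι → Set X) (U : Set X) : Prop :=
  ∃ A : Set X, A.Countable ∧ ∀ x ∈ U, ∃ a ∈ A, ∀ i, x ∈ C i → a ∈ C i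

section Dominated

variable {X : Type u} {ι : Type*} {C : ι → Set X} {U V : Set X}

theorem IsDominated.mono (h : IsDominated C V) (hUV : U ⊆ V) : IsDominated C U := by
  obtain ⟨A, hA, hAV⟩ := h
  exact ⟨A, hA, fun x hx => hAV x (hUV hx)⟩

theorem Set.Countable.isDominated (h : U.Countable) : IsDominated C U :=
  ⟨U, h, fun x hx => ⟨x, hx, fun _ => id⟩⟩

theorem IsDominated.biUnion {κ : Type*} {s : Set κ} (hs : s.Countable) {W : κ → Set X}
    (h : ∀ k ∈ s, IsDominated C (W k)) : IsDominated C (⋃ k ∈ s, W k) := by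
  choose! A hA hAW using h
  refine ⟨⋃ k ∈ s, A k, hs.biUnion hA, fun x hx => ?_⟩
  simp only [mem_iUnion, exists_prop] at hx ⊢
  obtain ⟨k, hk, hx⟩ := hx
  obtain ⟨a, ha, hax⟩ := hAW k hk x hx
  exact ⟨a, ⟨k, hk, ha⟩, hax⟩

theorem IsDominated.union (hU : IsDominated C U) (hV : IsDominated C V) :
    IsDominated C (U ∪ V) := by
  obtain ⟨A, hA, hAU⟩ := hU
  obtain ⟨B, hB, hBV⟩ := hV
  refine ⟨A ∪ B, hA.union hB, ?_⟩
  rintro x (hx | hx)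
  · obtain ⟨a, ha, hax⟩ := hAU x hx
    exact ⟨a, Or.inl ha, hax⟩
  · obtain ⟨a, ha, hax⟩ := hBV x hx
    exact ⟨a, Or.inr ha, hax⟩

end Dominated

theorem exponentiallySeparable_of_isDominated {X : Type u} [TopologicalSpace X]
    (h : ∀ F : Set (Set X), F.Countable → (∀ S ∈ F, IsClosed S) →
      IsDominated (fun S : F => (S : Set X)) univ) : ExponentiallySeparable X := by
  intro F hF hFc
  obtain ⟨A, hA, hAX⟩ := h F hF hFc
  refine ⟨A, hA, fun G hG ⟨x, hx⟩ => ?_⟩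
  obtain ⟨a, ha, hax⟩ := hAX x (mem_univ x)
  exact ⟨a, ha, fun S hS => hax ⟨S, hG hS⟩ (hx S hS)⟩

/-! ### Convex neighbourhoods -/

/-- Every point has a neighbourhood basis of order-convex sets. Together with
`OrderClosedTopology`, this describes GO spaces internally. -/
class HasConvexNhds (X : Type u) [TopologicalSpace X] [Preorder X] : Prop where
  exists_ordConnected_subset : ∀ x : X, ∀ U ∈ 𝓝 x, ∃ V ∈ 𝓝 x, V.OrdConnected ∧ V ⊆ U

instance {X : Type u} [TopologicalSpace X] [Preorder X] [HasConvexNhds X] : HasConvexNhds Xᵒᵈ where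
  exists_ordConnected_subset x U hU := by
    obtain ⟨V, hV, hVc, hVU⟩ :=
      HasConvexNhds.exists_ordConnected_subset (OrderDual.ofDual x) (OrderDual.toDual ⁻¹' U) hU
    exact ⟨OrderDual.ofDual ⁻¹' V, hV, hVc.dual, hVU⟩

theorem Topology.IsEmbedding.hasConvexNhds {X : Type u} {Y : Type v} [TopologicalSpace X]
    [Preorder X] [TopologicalSpace Y] [LinearOrder Y] [OrderTopology Y] {f : X → Y}
    (hf : IsEmbedding f) (hmono : Monotone f) : HasConvexNhds X where
  exists_ordConnected_subset x U hU := by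
    rw [hf.nhds_eq_comap, mem_comap] at hU
    obtain ⟨T, hT, hTU⟩ := hU
    refine ⟨f ⁻¹' T.ordConnectedComponent (f x), ?_, ?_, ?_⟩
    · exact hf.continuous.continuousAt.preimage_mem_nhds (ordConnectedComponent_mem_nhds.2 hT)
    · exact OrdConnected.preimage_mono inferInstance hmono
    · exact (preimage_mono ordConnectedComponent_subset).trans hTU

/-! ### Locally dominated convex sets -/

section Order

variable {X : Type u} [TopologicalSpace X] [LinearOrder X] [OrderClosedTopology X]
  [HasConvexNhds X] {ι : Type*} [Countable ι] {C : ι → Set X} {Z : Set X}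

/-- In a closed set without countable cofinal subsets, countably many closed unbounded sets have a
common point: otherwise a maximal set of points such that all the given sets meet each interval
between two of them would be closed and discrete, hence countable and bounded, hence extendable. -/
theorem exists_mem_of_unbounded (hext : HasCountableExtent X) (hC : ∀ i, IsClosed (C i))
    {K : Set X} (hK : IsClosed K) (hbdd : ∀ Q ⊆ K, Q.Countable → ∃ b ∈ K, ∀ q ∈ Q, q < b)
    {I : Set ι} (hI : ∀ i ∈ I, ∀ z ∈ K, ∃ c ∈ C i ∩ K, z < c) :
    ∃ a ∈ K, ∀ i ∈ I, a ∈ C i := by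
  by_contra! hcon
  obtain ⟨D, hDK, hD, hmax⟩ := hext.exists_maximal_pairwise
      (fun x y => ∀ i ∈ I, ∃ c ∈ C i, x < c ∧ c < y) K (by
    intro p
    by_cases hp : p ∈ K
    · obtain ⟨i, hi, hpi⟩ := hcon p hp
      obtain ⟨V, hV, hVc, hVC⟩ := HasConvexNhds.exists_ordConnected_subset p _
        ((hC i).isOpen_compl.mem_nhds hpi)
      refine ⟨V, hV, fun x hx y hy _ hP => ?_⟩
      obtain ⟨c, hc, hxc, hcy⟩ := hP i hi
      exact hVC (hVc.out hx.1 hy.1 ⟨hxc.le, hcy.le⟩) hc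
    · exact ⟨Kᶜ, hK.isOpen_compl.mem_nhds hp, fun x hx => absurd hx.2 hx.1⟩)
  obtain ⟨b, hbK, hb⟩ := hbdd D hDK hD
  have : Nonempty X := ⟨b⟩
  choose! c hc hbc using fun i (hi : i ∈ I) => hI i hi b hbK
  obtain ⟨d, hdK, hd⟩ := hbdd (insert b (c '' I))
    (insert_subset hbK (image_subset_iff.2 fun i hi => (hc i hi).2))
    ((I.to_countable.image c).insert b)
  have hbd : b < d := hd b (mem_insert _ _)
  have hdD : d ∈ D := hmax d hdK fun x hx =>
    ⟨fun _ i hi => ⟨c i, (hc i hi).1, (hb x hx).trans (hbc i hi),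
      hd _ (mem_insert_of_mem _ (mem_image_of_mem c hi))⟩,
      fun hdx => absurd ((hb x hx).trans hbd) hdx.not_gt⟩
  exact (hb d hdD).not_gt hbd

/-- If no countable set is cofinal in the given set, then the `C i` bounded in it have a common
bound `b`, and beyond `b` any common point of the unbounded ones dominates. -/
theorem isDominated_right_of_locally (hext : HasCountableExtent X) (hC : ∀ i, IsClosed (C i))
    (hZ : IsClosed Z) (hloc : ∀ z ∈ Z, ∃ V ∈ 𝓝 z, IsDominated C V) (d : X) :
    IsDominated C {z ∈ Z | d ≤ z ∧ IsDominated C (Icc d z)} := by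
  set K := {z ∈ Z | d ≤ z ∧ IsDominated C (Icc d z)}
  by_cases hcof : ∃ Q ⊆ K, Q.Countable ∧ ∀ z ∈ K, ∃ q ∈ Q, z ≤ q
  · obtain ⟨Q, hQK, hQ, hcof⟩ := hcof
    refine (IsDominated.biUnion hQ fun q hq => (hQK hq).2.2).mono fun z hz => ?_
    obtain ⟨q, hq, hzq⟩ := hcof z hz
    exact mem_biUnion hq ⟨hz.2.1, hzq⟩
  have hbdd : ∀ Q ⊆ K, Q.Countable → ∃ b ∈ K, ∀ q ∈ Q, q < b := by
    push Not at hcof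
    exact hcof
  have hKc : IsClosed K := by
    refine isClosed_of_closure_subset fun p hp => ?_
    have hpZ : p ∈ Z := closure_minimal (fun z hz => hz.1) hZ hp
    have hdp : d ≤ p := closure_minimal (fun z hz => hz.2.1) isClosed_Ici hp
    obtain ⟨U, hU, hUdom⟩ := hloc p hpZ
    obtain ⟨V, hV, hVc, hVU⟩ := HasConvexNhds.exists_ordConnected_subset p U hU
    obtain ⟨k, hkV, hkK⟩ := mem_closure_iff_nhds.1 hp V hV
    refine ⟨hpZ, hdp, (hkK.2.2.union hUdom).mono fun x hx => ?_⟩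
    rcases le_or_gt x k with hxk | hkx
    · exact Or.inl ⟨hx.1, hxk⟩
    · exact Or.inr (hVU (hVc.out hkV (mem_of_mem_nhds hV) ⟨hkx.le, hx.2⟩))
  obtain ⟨a, -, ha⟩ := exists_mem_of_unbounded hext hC hKc hbdd
    (I := {i | ∀ z ∈ K, ∃ c ∈ C i ∩ K, z < c}) (fun i hi => hi)
  have hbound : ∀ i ∈ {i | ∀ z ∈ K, ∃ c ∈ C i ∩ K, z < c}ᶜ, ∃ z ∈ K, ∀ c ∈ C i ∩ K, c ≤ z := by
    intro i hi
    simpa using hi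
  have : Nonempty X := ⟨d⟩
  choose! z hzK hz using hbound
  obtain ⟨b, hbK, hb⟩ := hbdd (z '' {i | ∀ z ∈ K, ∃ c ∈ C i ∩ K, z < c}ᶜ)
    (image_subset_iff.2 hzK) ((to_countable _).image z)
  have hadom : IsDominated C (K ∩ Ioi b) := by
    refine ⟨{a}, countable_singleton a, fun x hx => ⟨a, rfl, fun i hxi => ha i ?_⟩⟩
    by_contra hi
    exact ((hz i hi x ⟨hxi, hx.1⟩).trans_lt (hb _ (mem_image_of_mem z hi))).not_gt hx.2
  refine (hbK.2.2.union hadom).mono fun x hx => ?_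
  rcases le_or_gt x b with hxb | hbx
  · exact Or.inl ⟨hx.2.1, hxb⟩
  · exact Or.inr ⟨hx, hbx⟩

/-- The mirror image of `isDominated_right_of_locally`, obtained in the order dual. -/
theorem isDominated_left_of_locally (hext : HasCountableExtent X) (hC : ∀ i, IsClosed (C i))
    (hZ : IsClosed Z) (hloc : ∀ z ∈ Z, ∃ V ∈ 𝓝 z, IsDominated C V) (d : X) :
    IsDominated C {z ∈ Z | z ≤ d ∧ IsDominated C (Icc z d)} := by
  have h := isDominated_right_of_locally (X := Xᵒᵈ) (C := C) (Z := Z) hext hC hZ hloc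
    (OrderDual.toDual d)
  refine IsDominated.mono (X := X) h fun z hz => ⟨hz.1, hz.2.1, ?_⟩
  exact IsDominated.mono (X := X) hz.2.2 fun x hx => ⟨hx.2, hx.1⟩

/-- A closed set that is locally dominated is dominated; this is the only passage from local to
global, and it rests on countable extent. -/
theorem isDominated_of_locally (hext : HasCountableExtent X) (hC : ∀ i, IsClosed (C i))
    (hZ : IsClosed Z) (hloc : ∀ z ∈ Z, ∃ V ∈ 𝓝 z, IsDominated C V) : IsDominated C Z := by
  obtain ⟨D, hDZ, hD, hmax⟩ := hext.exists_maximal_pairwise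
      (fun x y => ¬ IsDominated C (Icc x y)) Z (by
    intro p
    by_cases hp : p ∈ Z
    · obtain ⟨U, hU, hUdom⟩ := hloc p hp
      obtain ⟨V, hV, hVc, hVU⟩ := HasConvexNhds.exists_ordConnected_subset p U hU
      exact ⟨V, hV, fun x hx y hy _ hP => hP (hUdom.mono ((hVc.out hx.1 hy.1).trans hVU))⟩
    · exact ⟨Zᶜ, hZ.isOpen_compl.mem_nhds hp, fun x hx => absurd hx.2 hx.1⟩)
  refine (IsDominated.biUnion hD fun d _ =>
    (isDominated_right_of_locally hext hC hZ hloc d).union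
      (isDominated_left_of_locally hext hC hZ hloc d)).mono fun z hz => ?_
  by_contra hcon
  simp only [mem_iUnion, not_exists] at hcon
  have hzD : z ∈ D := hmax z hz fun d hd =>
    ⟨fun hdz h => hcon d hd (Or.inl ⟨hz, hdz.le, h⟩),
      fun hzd h => hcon d hd (Or.inr ⟨hz, hzd.le, h⟩)⟩
  exact hcon z hzD (Or.inl ⟨hz, le_rfl, by rw [Icc_self]; exact (countable_singleton z).isDominated⟩)

/-! ### Scattered spaces -/

/-- One-sided extension of local domination to an exceptional point `x`: if a countable set decreases
to `x`, then a right neighbourhood of `x` is `{x}` and countably many closed intervals away from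
`x`; otherwise `x` alone dominates a right neighbourhood. -/
theorem exists_isDominated_inter_Ici (hext : HasCountableExtent X) (hC : ∀ i, IsClosed (C i))
    {x : X} {U : Set X} (hU : U ∈ 𝓝 x)
    (hloc : ∀ z ∈ U, z ≠ x → ∃ V ∈ 𝓝 z, IsDominated C V) :
    ∃ W ∈ 𝓝 x, IsDominated C (W ∩ Ici x) := by
  by_cases hright : ∀ W ∈ 𝓝 x, (W ∩ Ioi x).Nonempty
  swap
  · -- Here `x` is isolated from the right.
    push Not at hright
    obtain ⟨W, hW, hWe⟩ := hright
    refine ⟨W, hW, (countable_singleton x).isDominated.mono fun z hz => ?_⟩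
    by_contra hzx
    exact hWe.subset (⟨hz.1, lt_of_le_of_ne hz.2 (Ne.symm hzx)⟩ : z ∈ W ∩ Ioi x)
  obtain ⟨V, hV, hVc, hVU⟩ := HasConvexNhds.exists_ordConnected_subset x U hU
  obtain ⟨v, hvV, hxv⟩ := hright V hV
  by_cases hcof : ∃ Q ⊆ Ioc x v, Q.Countable ∧ ∀ y ∈ Ioc x v, ∃ q ∈ Q, q ≤ y
  · obtain ⟨Q, hQv, hQ, hcof⟩ := hcof
    have hdom : ∀ q ∈ Q, IsDominated C (Icc q v) := fun q hq =>
      isDominated_of_locally hext hC isClosed_Icc fun z hz =>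
        hloc z (hVU (hVc.out (mem_of_mem_nhds hV) hvV ⟨(hQv hq).1.le.trans hz.1, hz.2⟩))
          ((hQv hq).1.trans_le hz.1).ne'
    refine ⟨Iio v, Iio_mem_nhds hxv, ((countable_singleton x).isDominated.union
      (IsDominated.biUnion hQ hdom)).mono fun z hz => ?_⟩
    rcases eq_or_lt_of_le (show x ≤ z from hz.2) with rfl | hxz
    · exact Or.inl rfl
    · obtain ⟨q, hq, hqz⟩ := hcof z ⟨hxz, hz.1.le⟩
      exact Or.inr (mem_biUnion hq ⟨hqz, hz.1.le⟩)
  · have hmiss : ∀ i ∈ {i | x ∉ C i}, ∃ q ∈ Ioc x v, Icc x q ⊆ (C i)ᶜ := by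
      intro i hi
      obtain ⟨W, hW, hWc, hWC⟩ := HasConvexNhds.exists_ordConnected_subset x _
        ((hC i).isOpen_compl.mem_nhds hi)
      obtain ⟨q, hq, hxq⟩ := hright (W ∩ Iio v) (inter_mem hW (Iio_mem_nhds hxv))
      exact ⟨q, ⟨hxq, hq.2.le⟩, (hWc.out (mem_of_mem_nhds hW) hq.1).trans hWC⟩
    have : Nonempty X := ⟨x⟩
    choose! q hqv hq using hmiss
    push Not at hcof
    obtain ⟨y, hy, hyq⟩ := hcof (q '' {i | x ∉ C i}) (image_subset_iff.2 hqv)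
      ((to_countable _).image q)
    refine ⟨Iio y, Iio_mem_nhds hy.1, {x}, countable_singleton x,
      fun z hz => ⟨x, rfl, fun i hzi => ?_⟩⟩
    by_contra hxi
    exact hq i hxi ⟨hz.2, ((show z < y from hz.1).trans (hyq _ (mem_image_of_mem q hxi))).le⟩ hzi

theorem exists_isDominated_nhds_of_isScatteredSpace (hext : HasCountableExtent X)
    (hC : ∀ i, IsClosed (C i)) (hX : IsScatteredSpace X) (x : X) :
    ∃ V ∈ 𝓝 x, IsDominated C V := by
  by_contra hx
  obtain ⟨y, hy, U, hU, hUy⟩ := hX {x | ¬ ∃ V ∈ 𝓝 x, IsDominated C V} ⟨x, hx⟩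
  have hyU : U ∈ 𝓝 y := hU.mem_nhds (hUy.ge rfl).1
  have hloc : ∀ z ∈ U, z ≠ y → ∃ V ∈ 𝓝 z, IsDominated C V := fun z hz hzy => by
    by_contra hcon
    exact hzy (hUy.le ⟨hz, hcon⟩)
  obtain ⟨W₁, hW₁, hdom₁⟩ := exists_isDominated_inter_Ici hext hC hyU hloc
  obtain ⟨W₂, hW₂, hdom₂⟩ := exists_isDominated_inter_Ici (X := Xᵒᵈ) (C := C)
    (x := OrderDual.toDual y) hext hC hyU hloc
  -- Restates `hdom₂` in the order of `X` rather than in its dual.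
  have hdom₃ : IsDominated C ((W₂ : Set X) ∩ Iic y : Set X) := hdom₂
  refine hy ⟨W₁ ∩ W₂, inter_mem hW₁ hW₂, (hdom₁.union hdom₃).mono fun z hz => ?_⟩
  rcases le_total y z with h | h
  · exact Or.inl ⟨hz.1, h⟩
  · exact Or.inr ⟨hz.2, h⟩

/-! ### The equivalence for GO spaces -/

theorem HasCountableExtent.exponentiallySeparable (hext : HasCountableExtent X)
    (hX : IsScatteredSpace X ∨ IsLocallyCountable X) : ExponentiallySeparable X := by
  refine exponentiallySeparable_of_isDominated fun F hF hFc => ?_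
  have := hF.to_subtype
  have hC : ∀ S : F, IsClosed (S : Set X) := fun S => hFc S S.2
  refine isDominated_of_locally hext hC isClosed_univ fun x _ => ?_
  rcases hX with hX | hX
  · exact exists_isDominated_nhds_of_isScatteredSpace hext hC hX x
  · obtain ⟨V, hV, hVc⟩ := hX x
    exact ⟨V, hV, hVc.isDominated⟩

end Order

theorem mainTheorem2 {X : Type u} [TopologicalSpace X] (hGO : IsGOSpace.{u, v} X)
    (hX : IsScatteredSpace X ∨ IsLocallyCountable X) :
    List.TFAE [FunctionallyCountable X, ExponentiallySeparable X, HasCountableExtent X] := by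
  obtain ⟨Y, _, _, _, f, hf⟩ := hGO
  let _ : LinearOrder X := LinearOrder.lift' f hf.injective
  have hmono : Monotone f := fun _ _ h => h
  have : OrderClosedTopology X :=
    ⟨isClosed_le (α := Y) (hf.continuous.comp continuous_fst) (hf.continuous.comp continuous_snd)⟩
  have : HasConvexNhds X := hf.hasConvexNhds hmono
  have : T5Space X := hf.t5Space
  tfae_have 2 → 1 := ExponentiallySeparable.functionallyCountable
  tfae_have 1 → 3 := FunctionallyCountable.hasCountableExtent
  tfae_have 3 → 2 := fun h => h.exponentiallySeparable hX
  tfae_finish
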